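/- Let $d\in\{2,3\}$. There is an exponent $\alpha\in(0,1)$, depending only on $d$, such that the following holds. Let $D\subset\mathbb{R}^d$ be a bounded domain (open and connected), and let $n\in C^1(D)$ be real-valued and bounded. Let $z_1,\dots,z_M\in D$, and let $c_0>0$ be such that $|z_i-z_j|\ge c_0$ for $i\neq j$ and $\operatorname{dist}(z_m,\partial D)\ge c_0$ for all $m$. Let $B_1,\dots,B_M\subset\mathbb{R}^d$ be bounded open sets (for example smooth deformations of a ball centered at the origin), and let $n_1,\dots,n_M$ be real constants. For $\varepsilon>0$ such that the defects $z_m+\varepsilon B_m$ are pairwise disjoint, let $n_\varepsilon=n_m$ on $z_m+\varepsilon B_m$ for $m=1,\dots,M$ and $n_\varepsilon=n$ off the defects; let $n_0=n$. Let $X(D)=\{(w,v): w,v\in H^1(D),\ w-v\in H^1_0(D)\}$ (complex-valued functions), with the inner product of $H^1(D)\times H^1(D)$, where $H^1_0(D)$ is the closure of $C_c^\infty(D)$ in $H^1(D)$. Let $\mathbf{B}_\varepsilon:X(D)\to X(D)$ be the bounded linear operator given by the Riesz representation theorem through $$\big(\mathbf{B}_\varepsilon(w,v);(\varphi_1,\varphi_2)\big)_{X(D)}=\int_D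 n_\varepsilon w\,\overline{\varphi}_1-v\,\overline{\varphi}_2\,dx\qquad\text{for all }(w,v),(\varphi_1,\varphi_2)\in X(D).$$ Then for all sufficiently small $\varepsilon>0$ the defects are pairwise disjoint and contained in $D$; the operators $\mathbf{B}_0$ and $\mathbf{B}_\varepsilon$ (for every $\varepsilon>0$ with pairwise disjoint defects) exist; $\mathbf{B}_\varepsilon\to\mathbf{B}_0$ in the operator norm as $\varepsilon\to0^+$; and there is a constant $C$ independent of $\varepsilon$ such that $$\|\mathbf{B}_\varepsilon-\mathbf{B}_0\|\le C\,\varepsilon^{\alpha}$$ for every $\varepsilon>0$ for which the defects are pairwise disjoint. -/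

import Mathlib

open Filter Topology MeasureTheory
open scoped ContDiff ComplexConjugate

noncomputable section

namespace Transmission

/-- Euclidean space of dimension `d`. -/
abbrev E (d : ℕ) : Type := EuclideanSpace ℝ (Fin d)

/-- Lebesgue measure on `D`. -/
abbrev vol {d : ℕ} (D : Set (E d)) : Measure (E d) := (volume : Measure (E d)).restrict D

/-- `φ` belongs to `C_c^∞(D; F)`. -/
structure IsTest {d : ℕ} {F : Type*} [NormedAddCommGroup F] [NormedSpace ℝ F]
    (D : Set (E d)) (φ : E d → F) : Prop where
  smooth : ContDiff ℝ ∞ φ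
  compact : HasCompactSupport φ
  support : tsupport φ ⊆ D

/-- The partial derivative `∂φ/∂x_i` of a real function. -/
def partialDeriv {d : ℕ} (i : Fin d) (φ : E d → ℝ) (x : E d) : ℝ :=
  fderiv ℝ φ x (EuclideanSpace.single i 1)

/-- `g` is the weak gradient of `u` on `D`. -/
def IsWeakGradient {d : ℕ} (D : Set (E d)) (u : E d → ℂ)
    (g : E d → EuclideanSpace ℂ (Fin d)) : Prop :=
  ∀ φ : E d → ℝ, IsTest D φ → ∀ i : Fin d,
    ∫ x in D, u x * (partialDeriv i φ x : ℂ) = - ∫ x in D, g x i * (φ x : ℂ)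

/-- `L²(D) × L²(D)^d` with the Hilbert space structure of the product. -/
abbrev L2Pair {d : ℕ} (D : Set (E d)) : Type :=
  WithLp 2 (Lp ℂ 2 (vol D) × Lp (EuclideanSpace ℂ (Fin d)) 2 (vol D))

theorem IsTest.memLp {d : ℕ} {D : Set (E d)} {φ : E d → ℝ} (h : IsTest D φ) :
    MemLp (fun x => (φ x : ℂ)) 2 (vol D) := by
  have h1 : Continuous (fun x => (φ x : ℂ)) :=
    Complex.continuous_ofReal.comp h.smooth.continuous
  have h2 : HasCompactSupport (fun x => (φ x : ℂ)) :=
    h.compact.comp_left (g := fun t : ℝ => (t : ℂ)) (by simp)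
  exact (h1.memLp_of_hasCompactSupport (μ := volume) h2).restrict D

theorem IsTest.memLp_partialDeriv {d : ℕ} {D : Set (E d)} {φ : E d → ℝ} (h : IsTest D φ)
    (i : Fin d) : MemLp (fun x => (partialDeriv i φ x : ℂ)) 2 (vol D) := by
  have h0 : Continuous (partialDeriv i φ) :=
    (h.smooth.continuous_fderiv (by simp)).clm_apply continuous_const
  have h1 : Continuous (fun x => (partialDeriv i φ x : ℂ)) :=
    Complex.continuous_ofReal.comp h0
  have h2 : HasCompactSupport (fun x => (partialDeriv i φ x : ℂ)) :=
    (h.compact.fderiv (𝕜 := ℝ)).comp_left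
      (g := fun L : E d →L[ℝ] ℝ => ((L (EuclideanSpace.single i 1) : ℝ) : ℂ)) (by simp)
  exact (h1.memLp_of_hasCompactSupport (μ := volume) h2).restrict D

theorem memLp_coord {d : ℕ} {D : Set (E d)} (g : Lp (EuclideanSpace ℂ (Fin d)) 2 (vol D))
    (i : Fin d) : MemLp (fun x => g x i) 2 (vol D) :=
  (EuclideanSpace.proj (𝕜 := ℂ) i).comp_memLp' (Lp.memLp g)

/-- The Sobolev space `H¹(D)` of complex-valued functions, as the space of pairs `(u, ∇u)` in
`L²(D) × L²(D)^d`; the inherited inner product is `∫_D u ū' + ∇u · conj ∇u'`. -/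
def H1 {d : ℕ} (D : Set (E d)) : Submodule ℂ (L2Pair D) where
  carrier := {p | IsWeakGradient D p.fst p.snd}
  zero_mem' := by
    intro φ _ i
    have h1 : ∫ x in D, (((0 : L2Pair D).fst : E d → ℂ) x) * (partialDeriv i φ x : ℂ) = 0 := by
      rw [← integral_zero (E d) ℂ (μ := vol D)]
      refine integral_congr_ae ?_
      filter_upwards [Lp.coeFn_zero ℂ 2 (vol D)] with x hx
      simp only [WithLp.zero_fst, hx, Pi.zero_apply, zero_mul]
    have h2 : ∫ x in D, (((0 : L2Pair D).snd : E d → EuclideanSpace ℂ (Fin d)) x i) * (φ x : ℂ)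
        = 0 := by
      rw [← integral_zero (E d) ℂ (μ := vol D)]
      refine integral_congr_ae ?_
      filter_upwards [Lp.coeFn_zero (EuclideanSpace ℂ (Fin d)) 2 (vol D)] with x hx
      simp only [WithLp.zero_snd, hx, Pi.zero_apply, PiLp.zero_apply, zero_mul]
    rw [h1, h2, neg_zero]
  add_mem' := by
    intro p q hp hq φ hφ i
    have i1 := fun r : L2Pair D =>
      MemLp.integrable_mul (Lp.memLp r.fst) (hφ.memLp_partialDeriv i)
    have i2 := fun r : L2Pair D => MemLp.integrable_mul (memLp_coord r.snd i) hφ.memLp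
    have h1 : ∫ x in D, ((p + q).fst : E d → ℂ) x * (partialDeriv i φ x : ℂ)
        = (∫ x in D, p.fst x * (partialDeriv i φ x : ℂ))
          + ∫ x in D, q.fst x * (partialDeriv i φ x : ℂ) := by
      refine Eq.trans ?_ (integral_add (i1 p) (i1 q))
      refine integral_congr_ae ?_
      filter_upwards [Lp.coeFn_add p.fst q.fst] with x hx
      simp only [WithLp.add_fst, hx, Pi.add_apply, add_mul]
    have h2 : ∫ x in D, ((p + q).snd : E d → EuclideanSpace ℂ (Fin d)) x i * (φ x : ℂ)
        = (∫ x in D, p.snd x i * (φ x : ℂ)) + ∫ x in D, q.snd x i * (φ x : ℂ) := by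
      refine Eq.trans ?_ (integral_add (i2 p) (i2 q))
      refine integral_congr_ae ?_
      filter_upwards [Lp.coeFn_add p.snd q.snd] with x hx
      simp only [WithLp.add_snd, hx, Pi.add_apply, PiLp.add_apply, add_mul]
    rw [h1, h2, hp φ hφ i, hq φ hφ i, neg_add]
  smul_mem' := by
    intro c p hp φ hφ i
    have h1 : ∫ x in D, ((c • p).fst : E d → ℂ) x * (partialDeriv i φ x : ℂ)
        = c * ∫ x in D, p.fst x * (partialDeriv i φ x : ℂ) := by
      rw [← integral_const_mul]
      refine integral_congr_ae ?_
      filter_upwards [Lp.coeFn_smul c p.fst] with x hx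
      simp only [WithLp.smul_fst, hx, Pi.smul_apply, smul_eq_mul, mul_assoc]
    have h2 : ∫ x in D, ((c • p).snd : E d → EuclideanSpace ℂ (Fin d)) x i * (φ x : ℂ)
        = c * ∫ x in D, p.snd x i * (φ x : ℂ) := by
      rw [← integral_const_mul]
      refine integral_congr_ae ?_
      filter_upwards [Lp.coeFn_smul c p.snd] with x hx
      simp only [WithLp.smul_snd, hx, Pi.smul_apply, PiLp.smul_apply, smul_eq_mul, mul_assoc]
    rw [h1, h2, hp φ hφ i, mul_neg]

/-- `H¹₀(D)`: the closure of `C_c^∞(D)` in the norm of `H¹(D)`, which is the norm of the pair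
`(u, ∇u)`. (The set inside the span is already a subspace of `H¹(D)`.) -/
def H10 {d : ℕ} (D : Set (E d)) : Submodule ℂ (L2Pair D) :=
  (Submodule.span ℂ
    {p : L2Pair D | p ∈ H1 D ∧ ∃ φ : E d → ℂ, IsTest D φ ∧ p.fst =ᵐ[vol D] φ}).topologicalClosure

/-- `X(D)`: the pairs `(w, v)` with `w` and `v` in `H¹(D)` and `w - v` in `H¹₀(D)`, equipped with
the inner product of `H¹(D) × H¹(D)`. -/
def X {d : ℕ} (D : Set (E d)) : Submodule ℂ (WithLp 2 (L2Pair D × L2Pair D)) where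
  carrier := {p | p.fst ∈ H1 D ∧ p.snd ∈ H1 D ∧ p.fst - p.snd ∈ H10 D}
  zero_mem' := by
    refine ⟨(H1 D).zero_mem, (H1 D).zero_mem, ?_⟩
    simp
  add_mem' := by
    rintro p q ⟨hp1, hp2, hp3⟩ ⟨hq1, hq2, hq3⟩
    refine ⟨(H1 D).add_mem hp1 hq1, (H1 D).add_mem hp2 hq2, ?_⟩
    rw [WithLp.add_fst, WithLp.add_snd, add_sub_add_comm]
    exact (H10 D).add_mem hp3 hq3
  smul_mem' := by
    rintro c p ⟨hp1, hp2, hp3⟩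
    refine ⟨(H1 D).smul_mem c hp1, (H1 D).smul_mem c hp2, ?_⟩
    rw [WithLp.smul_fst, WithLp.smul_snd, ← smul_sub]
    exact (H10 D).smul_mem c hp3

/-- The function `w` of an element `(w, v)` of `X(D)`. -/
def X.w {d : ℕ} {D : Set (E d)} (p : X D) : E d → ℂ :=
  (p : WithLp 2 (L2Pair D × L2Pair D)).fst.fst

/-- The function `v` of an element `(w, v)` of `X(D)`. -/
def X.v {d : ℕ} {D : Set (E d)} (p : X D) : E d → ℂ :=
  (p : WithLp 2 (L2Pair D × L2Pair D)).snd.fst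

/-- The sesquilinear form `∫_D q w conj(φ₁) - v conj(φ₂) dx` at `((w, v), (φ₁, φ₂))`. -/
def formB {d : ℕ} (D : Set (E d)) (q : E d → ℝ) (p φ : X D) : ℂ :=
  ∫ x in D, ((q x : ℂ) * X.w p x * conj (X.w φ x) - X.v p x * conj (X.v φ x))

/-- `B` is the bounded operator on `X(D)` that represents the form with coefficient `q` in the
sense of Riesz, `(B (w, v) ; (φ₁, φ₂))_{X(D)} = ∫_D q w conj(φ₁) - v conj(φ₂) dx`.
Mathlib's inner product is antilinear in its first argument. -/
def IsOperatorOf {d : ℕ} (D : Set (E d)) (q : E d → ℝ) (B : X D →L[ℂ] X D) : Prop :=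
  ∀ p φ : X D, inner ℂ φ (B p) = formB D q p φ

/-- The operator of a form is unique. -/
theorem IsOperatorOf.unique {d : ℕ} {D : Set (E d)} {q : E d → ℝ} {B B' : X D →L[ℂ] X D}
    (h : IsOperatorOf D q B) (h' : IsOperatorOf D q B') : B = B' := by
  ext1 p
  exact ext_inner_left ℂ fun φ => (h p φ).trans (h' p φ).symm

/-- The defect `z_m + ε B_m`. -/
def defect {d M : ℕ} (z : Fin M → E d) (S : Fin M → Set (E d)) (ε : ℝ) (m : Fin M) :
    Set (E d) :=
  (fun y => z m + ε • y) '' S m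

/-- `ε > 0`, and the defects `z_m + ε B_m` are pairwise disjoint, so that the perturbed
coefficient is well defined. -/
def Admissible {d M : ℕ} (z : Fin M → E d) (S : Fin M → Set (E d)) (ε : ℝ) : Prop :=
  0 < ε ∧ Pairwise fun i j => Disjoint (defect z S ε i) (defect z S ε j)

open Classical in
/-- The perturbed coefficient `n_ε`: it is `n_m` on `z_m + ε B_m` and `n` off the defects.
It is only used for pairwise disjoint defects, where the index `m` is unique. -/
def perturbed {d M : ℕ} (n : E d → ℝ) (z : Fin M → E d) (S : Fin M → Set (E d))
    (nm : Fin M → ℝ) (ε : ℝ) (x : E d) : ℝ :=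
  if h : ∃ m, x ∈ defect z S ε m then nm h.choose else n x

end Transmission

end

/-!
A smooth function `g` supported in a ball of radius `ρ` is `∂ᵢ H + c⁻¹ A`, where `A` and `H` are
the integrals of `g` over segments of length `c` in direction `i`, with weights `1` and `1 - s / c`.
A line meets the ball in length at most `2 ρ`, so by Cauchy–Schwarz the `L²` norms of `A` and `H`
are at most `√(2 ρ c) ‖g‖`. If `c` is at most the distance from the ball to `∂D`, then testing the
weak gradient of `u ∈ H¹(D)` against `H` gives `|∫ u g| = O(√ρ) ‖u‖_{H¹} ‖g‖`, and by duality `u`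
has `L²` norm `O(√ρ)` on the ball. Finally `B_ε - B₀ = w† (n_ε - n) w` with `w : X(D) → L²(D)` the
first component, and `n_ε - n` is bounded and lives on defects of radius `O(ε)`: the rate is `√ε`.
-/

noncomputable section

namespace Transmission

theorem eLpNorm_one_le_eLpNorm_two_mul_measure_support {α F : Type*}
    [MeasurableSpace α] [NormedAddCommGroup F] {μ : Measure α} {f : α → F}
    (hf : AEStronglyMeasurable f μ) :
    eLpNorm f 1 μ ≤ eLpNorm f 2 μ * μ (Function.support f) ^ (1 / 2 : ℝ) := by
  rw [← eLpNorm_restrict_eq_of_support_subset (p := 1) Set.Subset.rfl]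
  refine (eLpNorm_le_eLpNorm_mul_rpow_measure_univ one_le_two hf.restrict).trans ?_
  rw [Measure.restrict_apply_univ]
  norm_num only [ENNReal.toReal_one, ENNReal.toReal_ofNat]
  gcongr
  exact Measure.restrict_le_self

section SegmentAverage

variable {V F : Type*} [NormedAddCommGroup V] [NormedSpace ℝ V] [NormedAddCommGroup F]
  [NormedSpace ℝ F]

/-- The weighted average `∫₀ᶜ η(s) g(x - s v) ds` of `g` over the segment of length `c ‖v‖` that
ends at `x` and has direction `v`. -/
def segmentAverage (v : V) (c : ℝ) (η : ℝ → ℝ) (g : V → F) (x : V) : F :=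
  ∫ s in (0 : ℝ)..c, η s • g (x - s • v)

theorem hasFDerivAt_segmentAverage (v : V) (c : ℝ) {η : ℝ → ℝ} (hη : Continuous η) {g : V → F}
    (hg : ContDiff ℝ 1 g) (hgc : HasCompactSupport g) (x : V) :
    HasFDerivAt (segmentAverage v c η g) (segmentAverage v c η (fderiv ℝ g) x) x := by
  have hg' : Continuous (fderiv ℝ g) := hg.continuous_fderiv one_ne_zero
  have hg₀ : Continuous g := hg.continuous
  obtain ⟨K, hK⟩ := (hgc.fderiv (𝕜 := ℝ)).exists_bound_of_continuous hg'
  refine intervalIntegral.hasFDerivAt_integral_of_dominated_of_fderiv_le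
    (F' := fun y s => η s • fderiv ℝ g (y - s • v)) (bound := fun s => ‖η s‖ * K) univ_mem
    (.of_forall fun y => Continuous.aestronglyMeasurable (by fun_prop))
    (Continuous.intervalIntegrable (by fun_prop) _ _)
    (Continuous.aestronglyMeasurable (by fun_prop))
    (.of_forall fun s _ y _ => ?_) (Continuous.intervalIntegrable (by fun_prop) _ _)
    (.of_forall fun s _ y _ => ?_)
  · rw [norm_smul]
    gcongr
    exact hK _
  · have hgy : HasFDerivAt g (fderiv ℝ g (y - s • v)) (y - s • v) :=
      (hg.differentiable one_ne_zero _).hasFDerivAt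
    exact (hgy.comp y ((hasFDerivAt_id y).sub_const (s • v))).const_smul (η s)

theorem continuous_segmentAverage (v : V) (c : ℝ) {η : ℝ → ℝ} (hη : Continuous η) {g : V → F}
    (hg : Continuous g) : Continuous (segmentAverage v c η g) :=
  intervalIntegral.continuous_parametric_intervalIntegral_of_continuous' (by fun_prop) 0 c

end SegmentAverage

universe u in
theorem contDiff_segmentAverage {V F : Type u} [NormedAddCommGroup V] [NormedSpace ℝ V]
    [NormedAddCommGroup F] [NormedSpace ℝ F] (v : V) (c : ℝ) {η : ℝ → ℝ} (hη : Continuous η)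
    {g : V → F} {n : ℕ} (hg : ContDiff ℝ n g) (hgc : HasCompactSupport g) :
    ContDiff ℝ n (segmentAverage v c η g) := by
  induction n generalizing F with
  | zero =>
    rw [Nat.cast_zero, contDiff_zero] at hg ⊢
    exact continuous_segmentAverage v c hη hg
  | succ n ih =>
    rw [Nat.cast_succ, contDiff_succ_iff_hasFDerivAt]
    rw [Nat.cast_succ] at hg
    exact ⟨segmentAverage v c η (fderiv ℝ g), ih (hg.fderiv_right le_rfl) (hgc.fderiv (𝕜 := ℝ)),
      hasFDerivAt_segmentAverage v c hη (hg.of_le (by simp)) hgc⟩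

section SegmentAverage

variable {V F : Type*} [NormedAddCommGroup V] [NormedSpace ℝ V] [NormedAddCommGroup F]
  [NormedSpace ℝ F]

theorem fderiv_segmentAverage_apply [CompleteSpace F] (v : V) {c : ℝ} (hc : c ≠ 0) {g : V → F}
    (hg : ContDiff ℝ 1 g) (hgc : HasCompactSupport g) (x : V) :
    fderiv ℝ (segmentAverage v c (fun s => 1 - s / c) g) x v
      = g x - c⁻¹ • segmentAverage v c (fun _ => 1) g x := by
  have : Continuous (fderiv ℝ g) := hg.continuous_fderiv one_ne_zero
  have hline : ∀ s : ℝ, HasDerivAt (fun s : ℝ => g (x - s • v)) (-fderiv ℝ g (x - s • v) v) s :=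
    fun s => by
      have h := ((hasDerivAt_id s).smul_const v).const_sub x
      simpa [Function.comp_def] using
        ((hg.differentiable one_ne_zero _).hasFDerivAt).comp_hasDerivAt s h
  have hweight : ∀ s : ℝ, HasDerivAt (fun s : ℝ => 1 - s / c) (-c⁻¹) s := fun s => by
    simpa [div_eq_mul_inv] using ((hasDerivAt_id s).mul_const c⁻¹).const_sub 1
  have parts := intervalIntegral.integral_smul_deriv_eq_deriv_smul (a := 0) (b := c)
    (fun s _ => hweight s) (fun s _ => hline s)
    (Continuous.intervalIntegrable (by fun_prop) _ _)
    (Continuous.intervalIntegrable (by fun_prop) _ _)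
  rw [(hasFDerivAt_segmentAverage v c (by fun_prop) hg hgc x).fderiv, segmentAverage,
    ContinuousLinearMap.intervalIntegral_apply (Continuous.intervalIntegrable (by fun_prop) _ _)]
  simp only [smul_neg, neg_smul, intervalIntegral.integral_neg, intervalIntegral.integral_smul,
    div_self hc, sub_self, zero_smul, zero_div, sub_zero, one_smul, zero_sub] at parts
  simp only [segmentAverage, one_smul, _root_.smul_apply]
  rw [← neg_inj, parts]
  abel

theorem support_segmentAverage_subset {v : V} (hv : ‖v‖ ≤ 1) {c ρ : ℝ} (hc : 0 ≤ c)
    (η : ℝ → ℝ) {g : V → F} {z : V} (hg : Function.support g ⊆ Metric.closedBall z ρ) :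
    Function.support (segmentAverage v c η g) ⊆ Metric.closedBall z (ρ + c) := by
  refine Function.support_subset_iff'.2 fun x hx => ?_
  refine (intervalIntegral.integral_congr (g := fun _ => 0) fun s hs => ?_).trans
    intervalIntegral.integral_zero
  rw [Set.uIcc_of_le hc] at hs
  have hxs : x - s • v ∉ Metric.closedBall z ρ := fun hmem => hx <| by
    have hsv : dist x (x - s • v) ≤ c := by
      rw [dist_eq_norm, sub_sub_cancel, norm_smul, Real.norm_of_nonneg hs.1]
      exact (mul_le_of_le_one_right hs.1 hv).trans hs.2
    rw [Metric.mem_closedBall] at hmem ⊢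
    linarith [dist_triangle x (x - s • v) z]
  simp only [Function.support_subset_iff'.1 hg _ hxs, smul_zero]

theorem volume_setOf_sub_smul_mem_le {v : V} (hv : ‖v‖ = 1) (x : V) (A : Set V) :
    volume {s : ℝ | x - s • v ∈ A} ≤ Metric.ediam A := by
  have hiso : Isometry fun s : ℝ => x - s • v := Isometry.of_dist_eq fun s t => by
    rw [dist_sub_left, dist_eq_norm, ← sub_smul, norm_smul, hv, mul_one, ← dist_eq_norm]
  refine (Real.volume_le_diam _).trans ?_
  rw [← hiso.ediam_image]
  exact Metric.ediam_mono (Set.image_subset_iff.2 fun s hs => hs)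

theorem lintegral_lintegral_sub_smul [MeasurableSpace V] [BorelSpace V]
    [SecondCountableTopology V] (μ : Measure V) [SFinite μ] [μ.IsAddRightInvariant] (v : V)
    (c : ℝ) {f : V → ENNReal} (hf : Measurable f) :
    ∫⁻ x, (∫⁻ s in Set.Ioc 0 c, f (x - s • v)) ∂μ = ENNReal.ofReal c * ∫⁻ x, f x ∂μ := by
  have hmeas : Measurable fun q : V × ℝ => f (q.1 - q.2 • v) := by fun_prop
  rw [lintegral_lintegral_swap hmeas.aemeasurable]
  simp only [lintegral_sub_right_eq_self f, setLIntegral_const, Real.volume_Ioc, sub_zero,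
    mul_comm]

theorem enorm_segmentAverage_le {v : V} (hv : ‖v‖ = 1) {c : ℝ} (hc : 0 ≤ c) {η : ℝ → ℝ}
    (hη : ∀ s ∈ Set.Ioc 0 c, |η s| ≤ 1) {g : V → F} (hg : Continuous g) (x : V) :
    ‖segmentAverage v c η g x‖ₑ ≤
      (∫⁻ s in Set.Ioc 0 c, ‖g (x - s • v)‖ₑ ^ (2 : ℝ)) ^ (1 / 2 : ℝ)
        * Metric.ediam (Function.support g) ^ (1 / 2 : ℝ) := by
  set ν := (volume : Measure ℝ).restrict (Set.Ioc 0 c)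
  have hline : Continuous fun s : ℝ => g (x - s • v) := by fun_prop
  calc ‖segmentAverage v c η g x‖ₑ
      ≤ ∫⁻ s, ‖η s • g (x - s • v)‖ₑ ∂ν := by
        rw [segmentAverage, intervalIntegral.integral_of_le hc]
        exact enorm_integral_le_lintegral_enorm _
    _ ≤ ∫⁻ s, ‖g (x - s • v)‖ₑ ∂ν := by
        refine setLIntegral_mono' measurableSet_Ioc fun s hs => enorm_le_iff_norm_le.2 ?_
        rw [norm_smul]
        exact mul_le_of_le_one_left (norm_nonneg _) (hη s hs)
    _ = eLpNorm (fun s => g (x - s • v)) 1 ν := eLpNorm_one_eq_lintegral_enorm.symm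
    _ ≤ eLpNorm (fun s => g (x - s • v)) 2 ν
          * ν {s | x - s • v ∈ Function.support g} ^ (1 / 2 : ℝ) :=
        eLpNorm_one_le_eLpNorm_two_mul_measure_support hline.aestronglyMeasurable
    _ ≤ _ := by
        rw [eLpNorm_eq_lintegral_rpow_enorm_toReal two_ne_zero ENNReal.ofNat_ne_top,
          ENNReal.toReal_ofNat]
        gcongr
        exact (Measure.restrict_le_self _).trans (volume_setOf_sub_smul_mem_le hv x _)

theorem eLpNorm_segmentAverage_le [MeasurableSpace V] [BorelSpace V] [SecondCountableTopology V]
    (μ : Measure V) [SFinite μ] [μ.IsAddRightInvariant] {v : V} (hv : ‖v‖ = 1) {c : ℝ}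
    (hc : 0 ≤ c) {η : ℝ → ℝ} (hη : ∀ s ∈ Set.Ioc 0 c, |η s| ≤ 1) {g : V → F}
    (hg : Continuous g) :
    eLpNorm (segmentAverage v c η g) 2 μ
      ≤ (Metric.ediam (Function.support g) * ENNReal.ofReal c) ^ (1 / 2 : ℝ)
        * eLpNorm g 2 μ := by
  set δ := Metric.ediam (Function.support g)
  have hsq : Measurable fun x => ‖g x‖ₑ ^ (2 : ℝ) := by
    have := hg.enorm.measurable
    fun_prop
  have hline : Measurable fun x : V => ∫⁻ s in Set.Ioc 0 c, ‖g (x - s • v)‖ₑ ^ (2 : ℝ) :=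
    (hsq.comp (by fun_prop : Measurable fun q : V × ℝ => q.1 - q.2 • v)).lintegral_prod_right'
  rw [eLpNorm_eq_lintegral_rpow_enorm_toReal two_ne_zero ENNReal.ofNat_ne_top,
    eLpNorm_eq_lintegral_rpow_enorm_toReal two_ne_zero ENNReal.ofNat_ne_top,
    ENNReal.toReal_ofNat, ← ENNReal.mul_rpow_of_nonneg _ _ (by norm_num)]
  gcongr
  calc ∫⁻ x, ‖segmentAverage v c η g x‖ₑ ^ (2 : ℝ) ∂μ
      ≤ ∫⁻ x, (∫⁻ s in Set.Ioc 0 c, ‖g (x - s • v)‖ₑ ^ (2 : ℝ)) * δ ∂μ := by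
        refine lintegral_mono fun x => ?_
        refine (ENNReal.rpow_le_rpow (enorm_segmentAverage_le hv hc hη hg x)
          zero_le_two).trans_eq ?_
        rw [ENNReal.mul_rpow_of_nonneg _ _ zero_le_two, ← ENNReal.rpow_mul, ← ENNReal.rpow_mul,
          one_div, inv_mul_cancel₀ two_ne_zero, ENNReal.rpow_one, ENNReal.rpow_one]
    _ = δ * ENNReal.ofReal c * ∫⁻ x, ‖g x‖ₑ ^ (2 : ℝ) ∂μ := by
        rw [lintegral_mul_const _ hline, lintegral_lintegral_sub_smul μ v c hsq]
        ring

end SegmentAverage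

section Duality

variable {α : Type*} [MeasurableSpace α] {μ : Measure α}

theorem norm_integral_mul_le_eLpNorm {f g : α → ℂ} (hf : MemLp f 2 μ) (hg : MemLp g 2 μ) :
    ‖∫ x, f x * g x ∂μ‖ ≤ (eLpNorm f 2 μ).toReal * (eLpNorm g 2 μ).toReal := by
  rw [← ENNReal.toReal_mul, ← toReal_enorm]
  refine ENNReal.toReal_mono (ENNReal.mul_ne_top hf.2.ne hg.2.ne) ?_
  calc ‖∫ x, f x * g x ∂μ‖ₑ ≤ eLpNorm (f • g) 1 μ := by
        rw [eLpNorm_one_eq_lintegral_enorm]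
        exact enorm_integral_le_lintegral_enorm _
    _ ≤ eLpNorm f 2 μ * eLpNorm g 2 μ :=
        eLpNorm_smul_le_mul_eLpNorm (p := 2) (q := 2) (r := 1) (f := g) (φ := f) hg.1 hf.1

theorem integral_mul_eq_integral_mul_re_add_im {f g : α → ℂ} (hf : MemLp f 2 μ)
    (hg : MemLp g 2 μ) :
    ∫ x, f x * g x ∂μ
      = ∫ x, f x * ((g x).re : ℂ) ∂μ + (∫ x, f x * ((g x).im : ℂ) ∂μ) * Complex.I := by
  have hre : MemLp (fun x => ((g x).re : ℂ)) 2 μ := hg.re.ofReal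
  have him : MemLp (fun x => ((g x).im : ℂ)) 2 μ := hg.im.ofReal
  rw [← integral_mul_const]
  refine Eq.trans ?_ (integral_add (hf.integrable_mul hre)
    ((hf.integrable_mul him).mul_const Complex.I))
  congr 1 with x
  rw [mul_assoc, ← mul_add, Complex.re_add_im]

theorem norm_le_of_mem_closure_of_norm_inner_le {H : Type*} [NormedAddCommGroup H]
    [InnerProductSpace ℂ H] {s : Set H} {a b : H} {K : ℝ} (ha : a ∈ closure s)
    (hab : inner ℂ a b = inner ℂ a a) (hs : ∀ y ∈ s, ‖inner ℂ y b‖ ≤ K * ‖y‖) (hK : 0 ≤ K) :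
    ‖a‖ ≤ K := by
  have hclosed : IsClosed {y : H | ‖inner ℂ y b‖ ≤ K * ‖y‖} :=
    isClosed_le (by fun_prop) (by fun_prop)
  have hle : ‖inner ℂ a b‖ ≤ K * ‖a‖ := closure_minimal hs hclosed ha
  rw [hab, inner_self_eq_norm_sq_to_K, norm_pow, RCLike.norm_ofReal, abs_norm, sq] at hle
  rcases (norm_nonneg a).eq_or_lt with h | h
  · rwa [← h]
  · exact le_of_mul_le_mul_right hle h

theorem toLp_mem_closure_setOf_contDiff {V F : Type*} [NormedAddCommGroup V]
    [InnerProductSpace ℝ V] [FiniteDimensional ℝ V] [MeasurableSpace V] [BorelSpace V]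
    [NormedAddCommGroup F] [NormedSpace ℝ F] {μ : Measure V} [IsFiniteMeasureOnCompacts μ]
    {p : ENNReal} [Fact (1 ≤ p)] (hp : p ≠ ⊤) {f : V → F} (hf : MemLp f p μ) {z : V} {r R : ℝ}
    (hr : 0 < r) (hrR : r < R) (hfr : Function.support f ⊆ Metric.closedBall z r) :
    hf.toLp f ∈ closure {h : Lp F p μ |
      ∃ g : V → F, ContDiff ℝ ∞ g ∧ Function.support g ⊆ Metric.closedBall z R ∧ h =ᵐ[μ] g} := by
  refine (mem_closure_iff_nhds_basis Metric.nhds_basis_closedBall).2 fun δ hδ => ?_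
  obtain ⟨g, -, hg, hfg⟩ := hf.exist_eLpNorm_sub_le hp Fact.out hδ
  let χ : ContDiffBump z := ⟨r, R, hr, hrR⟩
  have hsupp : Function.support (fun x => χ x • g x) ⊆ Metric.closedBall z R :=
    (Function.support_smul_subset_left _ _).trans
      (χ.support_eq.subset.trans Metric.ball_subset_closedBall)
  have hsmooth : ContDiff ℝ ∞ fun x => χ x • g x := χ.contDiff.smul hg
  have hmem : MemLp (fun x => χ x • g x) p μ := hsmooth.continuous.memLp_of_hasCompactSupport
    (.of_support_subset_isCompact (isCompact_closedBall z R) hsupp)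
  have hcut : ∀ x, f x - χ x • g x = χ x • (f x - g x) := fun x => by
    by_cases hx : x ∈ Metric.closedBall z r
    · rw [χ.one_of_mem_closedBall hx, one_smul, one_smul]
    · rw [Function.support_subset_iff'.1 hfr x hx, zero_sub, zero_sub, smul_neg]
  refine ⟨hmem.toLp, ⟨_, hsmooth, hsupp, hmem.coeFn_toLp⟩, ?_⟩
  rw [Metric.mem_closedBall', Lp.dist_edist, Lp.edist_toLp_toLp]
  refine ENNReal.toReal_le_of_le_ofReal hδ.le (le_trans (eLpNorm_mono fun x => ?_) hfg)
  rw [Pi.sub_apply, Pi.sub_apply, hcut, norm_smul, Real.norm_of_nonneg χ.nonneg]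
  exact mul_le_of_le_one_left (norm_nonneg _) χ.le_one

end Duality

section LocalEstimate

variable {d : ℕ} {D : Set (E d)}

theorem IsTest.clm_comp {F G : Type*} [NormedAddCommGroup F] [NormedSpace ℝ F]
    [NormedAddCommGroup G] [NormedSpace ℝ G] (T : F →L[ℝ] G) {φ : E d → F} (hφ : IsTest D φ) :
    IsTest D fun x => T (φ x) where
  smooth := T.contDiff.comp hφ.smooth
  compact := hφ.compact.comp_left (map_zero T)
  support := (closure_mono (Function.support_comp_subset (map_zero T) φ)).trans hφ.support

theorem IsTest.of_support_subset_closedBall {F : Type*} [NormedAddCommGroup F] [NormedSpace ℝ F]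
    {φ : E d → F} (hφ : ContDiff ℝ ∞ φ) {z : E d} {ρ : ℝ}
    (hsupp : Function.support φ ⊆ Metric.closedBall z ρ) (hD : Metric.closedBall z ρ ⊆ D) :
    IsTest D φ where
  smooth := hφ
  compact := .of_support_subset_isCompact (isCompact_closedBall z ρ) hsupp
  support := (closure_minimal hsupp Metric.isClosed_closedBall).trans hD

theorem IsTest.memLp_complex {φ : E d → ℂ} (hφ : IsTest D φ) : MemLp φ 2 (vol D) :=
  (hφ.smooth.continuous.memLp_of_hasCompactSupport hφ.compact).restrict D

theorem IsTest.memLp_fderiv {φ : E d → ℂ} (hφ : IsTest D φ) (v : E d) :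
    MemLp (fun x => fderiv ℝ φ x v) 2 (vol D) :=
  have hcont : Continuous fun x => fderiv ℝ φ x v :=
    (hφ.smooth.continuous_fderiv (by simp)).clm_apply continuous_const
  (hcont.memLp_of_hasCompactSupport
    ((hφ.compact.fderiv (𝕜 := ℝ)).comp_left (g := fun L : E d →L[ℝ] ℂ => L v) rfl)).restrict D

theorem partialDeriv_clm_comp (i : Fin d) (T : ℂ →L[ℝ] ℝ) {φ : E d → ℂ} (hφ : ContDiff ℝ 1 φ)
    (x : E d) :
    partialDeriv i (fun x => T (φ x)) x = T (fderiv ℝ φ x (EuclideanSpace.single i 1)) := by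
  have hφx : HasFDerivAt φ (fderiv ℝ φ x) x := (hφ.differentiable one_ne_zero x).hasFDerivAt
  have hcomp : HasFDerivAt (fun x => T (φ x)) (T ∘L fderiv ℝ φ x) x := T.hasFDerivAt.comp x hφx
  rw [partialDeriv, hcomp.fderiv, ContinuousLinearMap.comp_apply]

theorem IsWeakGradient.integral_mul_fderiv {p : L2Pair D} (hp : IsWeakGradient D p.fst p.snd)
    {φ : E d → ℂ} (hφ : IsTest D φ) (i : Fin d) :
    ∫ x in D, p.fst x * fderiv ℝ φ x (EuclideanSpace.single i 1)
      = -∫ x in D, p.snd x i * φ x := by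
  have hre := hp _ (hφ.clm_comp Complex.reCLM) i
  have him := hp _ (hφ.clm_comp Complex.imCLM) i
  simp only [partialDeriv_clm_comp i _ (hφ.smooth.of_le (by simp))] at hre him
  simp only [Complex.reCLM_apply, Complex.imCLM_apply] at hre him
  rw [integral_mul_eq_integral_mul_re_add_im (Lp.memLp p.fst) (hφ.memLp_fderiv _),
    integral_mul_eq_integral_mul_re_add_im (memLp_coord p.snd i) hφ.memLp_complex, hre, him]
  ring

theorem toReal_eLpNorm_fst_le (p : L2Pair D) : (eLpNorm p.fst 2 (vol D)).toReal ≤ ‖p‖ :=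
  (Lp.norm_def p.fst).symm.trans_le (WithLp.norm_fst_le _ p)

theorem toReal_eLpNorm_snd_apply_le (p : L2Pair D) (i : Fin d) :
    (eLpNorm (fun x => p.snd x i) 2 (vol D)).toReal ≤ ‖p‖ := calc
  _ ≤ (eLpNorm p.snd 2 (vol D)).toReal :=
    ENNReal.toReal_mono (Lp.memLp p.snd).2.ne
      (eLpNorm_mono fun x => PiLp.norm_apply_le (p.snd x) i)
  _ = ‖p.snd‖ := (Lp.norm_def p.snd).symm
  _ ≤ ‖p‖ := WithLp.norm_snd_le _ p

theorem toReal_eLpNorm_segmentAverage_le {F : Type*} [NormedAddCommGroup F] [NormedSpace ℝ F]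
    {v : E d} (hv : ‖v‖ = 1) {c ρ : ℝ} (hc : 0 ≤ c) (hρ : 0 ≤ ρ) {η : ℝ → ℝ}
    (hη : ∀ s ∈ Set.Ioc 0 c, |η s| ≤ 1) {g : E d → F} (hg : Continuous g) {z : E d}
    (hsupp : Function.support g ⊆ Metric.closedBall z ρ) (hD : Metric.closedBall z ρ ⊆ D) :
    (eLpNorm (segmentAverage v c η g) 2 (vol D)).toReal
      ≤ √(2 * ρ * c) * (eLpNorm g 2 (vol D)).toReal := by
  have hgL : MemLp g 2 (vol D) := (hg.memLp_of_hasCompactSupport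
    (.of_support_subset_isCompact (isCompact_closedBall z ρ) hsupp)).restrict D
  have hdiam : Metric.ediam (Function.support g) ≤ ENNReal.ofReal (2 * ρ) := by
    rw [ENNReal.ofReal_mul zero_le_two, ENNReal.ofReal_ofNat]
    exact (Metric.ediam_mono (hsupp.trans_eq (Metric.closedEBall_ofReal hρ).symm)).trans
      Metric.ediam_closedEBall_le
  have hle : eLpNorm (segmentAverage v c η g) 2 (vol D)
      ≤ ENNReal.ofReal √(2 * ρ * c) * eLpNorm g 2 (vol D) := calc
    _ ≤ eLpNorm (segmentAverage v c η g) 2 volume :=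
      eLpNorm_mono_measure _ Measure.restrict_le_self
    _ ≤ (Metric.ediam (Function.support g) * ENNReal.ofReal c) ^ (1 / 2 : ℝ)
        * eLpNorm g 2 volume := eLpNorm_segmentAverage_le volume hv hc hη hg
    _ ≤ (ENNReal.ofReal (2 * ρ) * ENNReal.ofReal c) ^ (1 / 2 : ℝ) * eLpNorm g 2 volume := by
      gcongr
    _ = _ := by
      rw [← eLpNorm_restrict_eq_of_support_subset (hsupp.trans hD),
        ← ENNReal.ofReal_mul (by positivity), Real.sqrt_eq_rpow,
        ENNReal.ofReal_rpow_of_nonneg (by positivity) (by norm_num)]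
  have := ENNReal.toReal_mono (ENNReal.mul_ne_top ENNReal.ofReal_ne_top hgL.2.ne) hle
  rwa [ENNReal.toReal_mul, ENNReal.toReal_ofReal (Real.sqrt_nonneg _)] at this

theorem isTest_segmentAverage {v : E d} (hv : ‖v‖ ≤ 1) {c ρ : ℝ} (hc : 0 ≤ c) {η : ℝ → ℝ}
    (hη : Continuous η) {g : E d → ℂ} (hg : ContDiff ℝ ∞ g) {z : E d}
    (hsupp : Function.support g ⊆ Metric.closedBall z ρ)
    (hD : Metric.closedBall z (ρ + c) ⊆ D) : IsTest D (segmentAverage v c η g) :=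
  have hcompact : HasCompactSupport g :=
    .of_support_subset_isCompact (isCompact_closedBall z ρ) hsupp
  .of_support_subset_closedBall
    (contDiff_infty.2 fun _ =>
      contDiff_segmentAverage v c hη (hg.of_le (mod_cast le_top)) hcompact)
    (support_segmentAverage_subset hv hc η hsupp) hD

theorem integral_mul_eq_integral_mul_segmentAverage (i : Fin d) {p : L2Pair D} (hp : p ∈ H1 D)
    {z : E d} {c ρ : ℝ} (hc : 0 < c) (hD : Metric.closedBall z (ρ + c) ⊆ D) {g : E d → ℂ}
    (hg : ContDiff ℝ ∞ g) (hsupp : Function.support g ⊆ Metric.closedBall z ρ) :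
    ∫ x in D, p.fst x * g x
      = c⁻¹ * (∫ x in D,
          p.fst x * segmentAverage (EuclideanSpace.single i 1) c (fun _ => 1) g x)
        - ∫ x in D,
          p.snd x i * segmentAverage (EuclideanSpace.single i 1) c (fun s => 1 - s / c) g x := by
  have hcompact : HasCompactSupport g :=
    .of_support_subset_isCompact (isCompact_closedBall z ρ) hsupp
  have hv : ‖(EuclideanSpace.single i 1 : E d)‖ ≤ 1 := by simp
  set H := segmentAverage (EuclideanSpace.single i 1 : E d) c (fun s => 1 - s / c) g with hH_def
  set A := segmentAverage (EuclideanSpace.single i 1 : E d) c (fun _ => 1) g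
  have hH : IsTest D H := isTest_segmentAverage hv hc.le (by fun_prop) hg hsupp hD
  have hA : IsTest D A := isTest_segmentAverage hv hc.le continuous_const hg hsupp hD
  rw [sub_eq_add_neg, ← IsWeakGradient.integral_mul_fderiv hp hH i, ← integral_const_mul]
  refine Eq.trans ?_ (integral_add
    ((MemLp.integrable_mul (Lp.memLp p.fst) hA.memLp_complex).const_mul ((c⁻¹ : ℝ) : ℂ))
    (MemLp.integrable_mul (Lp.memLp p.fst) (hH.memLp_fderiv _)))
  congr 1 with x
  rw [hH_def, fderiv_segmentAverage_apply _ hc.ne' (hg.of_le (by simp)) hcompact,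
    Complex.real_smul]
  ring

theorem norm_integral_mul_le_of_support_subset_closedBall (i : Fin d) {p : L2Pair D}
    (hp : p ∈ H1 D) {z : E d} {c ρ : ℝ} (hc : 0 < c) (hρ : 0 ≤ ρ)
    (hD : Metric.closedBall z (ρ + c) ⊆ D) {g : E d → ℂ} (hg : ContDiff ℝ ∞ g)
    (hsupp : Function.support g ⊆ Metric.closedBall z ρ) :
    ‖∫ x in D, p.fst x * g x‖
      ≤ (1 + c⁻¹) * √(2 * ρ * c) * ‖p‖ * (eLpNorm g 2 (vol D)).toReal := by
  have hv : ‖(EuclideanSpace.single i 1 : E d)‖ = 1 := by simp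
  have hbound : ∀ (η : ℝ → ℝ) (u : E d → ℂ), Continuous η → (∀ s ∈ Set.Ioc 0 c, |η s| ≤ 1) →
      MemLp u 2 (vol D) → (eLpNorm u 2 (vol D)).toReal ≤ ‖p‖ →
      ‖∫ x in D, u x * segmentAverage (EuclideanSpace.single i 1) c η g x‖
        ≤ ‖p‖ * (√(2 * ρ * c) * (eLpNorm g 2 (vol D)).toReal) := by
    intro η u hη hη₁ hu hup
    have htest := isTest_segmentAverage hv.le hc.le hη hg hsupp hD
    refine (norm_integral_mul_le_eLpNorm hu htest.memLp_complex).trans ?_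
    gcongr
    exact toReal_eLpNorm_segmentAverage_le hv hc.le hρ hη₁ hg.continuous hsupp
      ((Metric.closedBall_subset_closedBall (by linarith)).trans hD)
  have hweight : ∀ s ∈ Set.Ioc 0 c, |1 - s / c| ≤ 1 := fun s hs => by
    have h₀ : 0 ≤ s / c := div_nonneg hs.1.le hc.le
    have h₁ : s / c ≤ 1 := (div_le_one hc).2 hs.2
    rw [abs_le]
    constructor <;> linarith
  have hA := hbound (fun _ => 1) p.fst continuous_const (by simp) (Lp.memLp p.fst)
    (toReal_eLpNorm_fst_le p)
  have hH := hbound (fun s => 1 - s / c) (fun x => p.snd x i) (by fun_prop) hweight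
    (memLp_coord p.snd i) (toReal_eLpNorm_snd_apply_le p i)
  rw [integral_mul_eq_integral_mul_segmentAverage i hp hc hD hg hsupp]
  calc _ ≤ c⁻¹ * (‖p‖ * (√(2 * ρ * c) * (eLpNorm g 2 (vol D)).toReal))
        + ‖p‖ * (√(2 * ρ * c) * (eLpNorm g 2 (vol D)).toReal) := by
        refine (norm_sub_le _ _).trans (add_le_add ?_ hH)
        rw [norm_mul, Complex.norm_of_nonneg (inv_nonneg.2 hc.le)]
        gcongr
    _ = _ := by ring

theorem toReal_eLpNorm_restrict_ball_le_of_closedBall_subset (i : Fin d) {p : L2Pair D}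
    (hp : p ∈ H1 D) {z : E d} {c r : ℝ} (hc : 0 < c) (hr : 0 < r)
    (hD : Metric.closedBall z (2 * r + c) ⊆ D) :
    (eLpNorm p.fst 2 ((vol D).restrict (Metric.ball z r))).toReal
      ≤ (1 + c⁻¹) * √(4 * r * c) * ‖p‖ := by
  have hf : MemLp ((Metric.ball z r).indicator p.fst) 2 (vol D) :=
    (Lp.memLp p.fst).indicator measurableSet_ball
  have hclosure := toLp_mem_closure_setOf_contDiff ENNReal.ofNat_ne_top hf hr
    (show r < 2 * r by linarith)
    (Set.support_indicator_subset.trans Metric.ball_subset_closedBall)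
  have hnorm : ‖hf.toLp _‖ = (eLpNorm p.fst 2 ((vol D).restrict (Metric.ball z r))).toReal := by
    rw [Lp.norm_toLp, eLpNorm_indicator_eq_eLpNorm_restrict measurableSet_ball]
  have hinner : inner ℂ (hf.toLp _) p.fst = inner ℂ (hf.toLp _) (hf.toLp _) := by
    rw [L2.inner_def, L2.inner_def]
    refine integral_congr_ae ?_
    filter_upwards [hf.coeFn_toLp] with x hx
    rw [hx]
    by_cases hxz : x ∈ Metric.ball z r <;> simp [hxz]
  rw [← hnorm]
  refine norm_le_of_mem_closure_of_norm_inner_le hclosure hinner ?_ (by positivity)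
  rintro y ⟨g, hg, hsupp, hyg⟩
  have hpair : inner ℂ y p.fst = ∫ x in D, p.fst x * conj (g x) := by
    rw [L2.inner_def]
    refine integral_congr_ae ?_
    filter_upwards [hyg] with x hx
    rw [hx, RCLike.inner_apply]
  have hconj : Function.support (fun x => conj (g x)) ⊆ Metric.closedBall z (2 * r) :=
    (Function.support_comp_subset (map_zero _) g).trans hsupp
  have hle := norm_integral_mul_le_of_support_subset_closedBall i hp hc (by linarith) hD
    (Complex.conjCLE.contDiff.comp hg) hconj
  rw [hpair, Lp.norm_def, eLpNorm_congr_ae hyg, show 4 * r * c = 2 * (2 * r) * c by ring]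
  refine hle.trans_eq ?_
  congr 2
  exact eLpNorm_congr_norm_ae (.of_forall fun x => RCLike.norm_conj (g x))

theorem toReal_eLpNorm_restrict_ball_le [NeZero d] {p : L2Pair D} (hp : p ∈ H1 D) {z : E d}
    {c₀ r : ℝ} (hc₀ : 0 < c₀) (hD : Metric.ball z c₀ ⊆ D) (hr : 0 < r) :
    (eLpNorm p.fst 2 ((vol D).restrict (Metric.ball z r))).toReal
      ≤ (1 + 2 / c₀) * √(2 * c₀ * r) * ‖p‖ := by
  rcases lt_or_ge r (c₀ / 4) with hlt | hge
  · have hball : Metric.closedBall z (2 * r + c₀ / 2) ⊆ D :=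
      (Metric.closedBall_subset_ball (by linarith)).trans hD
    convert toReal_eLpNorm_restrict_ball_le_of_closedBall_subset (0 : Fin d) hp
      (half_pos hc₀) hr hball using 4
    · rw [inv_div]
    · ring
  · have hsqrt : c₀ / 2 ≤ √(2 * c₀ * r) := Real.le_sqrt_of_sq_le (by nlinarith)
    have hone : 1 ≤ (1 + 2 / c₀) * √(2 * c₀ * r) := calc
      (1 : ℝ) = 2 / c₀ * (c₀ / 2) := by field_simp
      _ ≤ (1 + 2 / c₀) * √(2 * c₀ * r) := by gcongr; linarith
    calc (eLpNorm p.fst 2 ((vol D).restrict (Metric.ball z r))).toReal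
        ≤ (eLpNorm p.fst 2 (vol D)).toReal :=
          ENNReal.toReal_mono (Lp.memLp p.fst).2.ne
            (eLpNorm_mono_measure _ Measure.restrict_le_self)
      _ ≤ ‖p‖ := toReal_eLpNorm_fst_le p
      _ ≤ _ := le_mul_of_one_le_left (norm_nonneg p) hone

end LocalEstimate

section Operators

section Pullback

open scoped InnerProduct

variable {H K : Type*} [NormedAddCommGroup H] [InnerProductSpace ℂ H] {P : Submodule ℂ H}
  [CompleteSpace P] [NormedAddCommGroup K] [InnerProductSpace ℂ K] [CompleteSpace K]

/-- The operator `w† T w - v† v`, which represents the sesquilinear form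
`(p, φ) ↦ ⟪w φ, T (w p)⟫ - ⟪v φ, v p⟫`. -/
def pullbackOperator (w v : P →L[ℂ] K) (T : K →L[ℂ] K) : P →L[ℂ] P :=
  (w†) ∘L T ∘L w - (v†) ∘L v

theorem inner_pullbackOperator (w v : P →L[ℂ] K) (T : K →L[ℂ] K) (p φ : P) :
    inner ℂ φ (pullbackOperator w v T p) = inner ℂ (w φ) (T (w p)) - inner ℂ (v φ) (v p) := by
  simp [pullbackOperator, ContinuousLinearMap.adjoint_inner_right]

theorem norm_pullbackOperator_sub_le (w v : P →L[ℂ] K) {T T' : K →L[ℂ] K} {C : ℝ} (hC : 0 ≤ C)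
    (h : ∀ p, ‖T (w p) - T' (w p)‖ ≤ C * ‖p‖) :
    ‖pullbackOperator w v T - pullbackOperator w v T'‖ ≤ ‖w‖ * C := by
  refine ContinuousLinearMap.opNorm_le_bound _ (by positivity) fun p => ?_
  calc ‖(pullbackOperator w v T - pullbackOperator w v T') p‖
      = ‖(w†) (T (w p) - T' (w p))‖ := by simp [pullbackOperator]
    _ ≤ ‖w†‖ * ‖T (w p) - T' (w p)‖ := ContinuousLinearMap.le_opNorm _ _
    _ ≤ ‖w‖ * (C * ‖p‖) := by
      rw [LinearIsometryEquiv.norm_map]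
      gcongr
      exact h p
    _ = ‖w‖ * C * ‖p‖ := (mul_assoc _ _ _).symm

end Pullback

section Multiplication

variable {α : Type*} [MeasurableSpace α] {μ : Measure α}

/-- Multiplication by an essentially bounded function `q`, as an operator on `L²`. -/
def multiplicationOperator {q : α → ℝ} (hq : MemLp q ⊤ μ) : Lp ℂ 2 μ →L[ℂ] Lp ℂ 2 μ :=
  (ContinuousLinearMap.mul ℂ ℂ).holderL μ ⊤ 2 2 (hq.ofReal (K := ℂ)).toLp

theorem coeFn_multiplicationOperator {q : α → ℝ} (hq : MemLp q ⊤ μ) (f : Lp ℂ 2 μ) :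
    multiplicationOperator hq f =ᵐ[μ] fun x => (q x : ℂ) * f x := by
  filter_upwards [(ContinuousLinearMap.mul ℂ ℂ).coeFn_holder (r := 2) hq.ofReal.toLp f,
    (hq.ofReal (K := ℂ)).coeFn_toLp] with x hx hqx
  rw [multiplicationOperator, ContinuousLinearMap.holderL_apply_apply, hx, hqx]
  rfl

theorem eLpNorm_indicator_mul_le {h : α → ℝ} (hh : AEStronglyMeasurable h μ) {A : Set α}
    (hA : MeasurableSet A) {f : α → ℂ} (hf : AEStronglyMeasurable f μ) :
    eLpNorm (A.indicator fun x => (h x : ℂ) * f x) 2 μ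
      ≤ eLpNorm h ⊤ μ * eLpNorm f 2 (μ.restrict A) := by
  have hh' : AEStronglyMeasurable (fun x => (h x : ℂ)) μ :=
    Complex.continuous_ofReal.comp_aestronglyMeasurable hh
  calc eLpNorm (A.indicator fun x => (h x : ℂ) * f x) 2 μ
      = eLpNorm ((fun x => (h x : ℂ)) • f) 2 (μ.restrict A) :=
        eLpNorm_indicator_eq_eLpNorm_restrict hA
    _ ≤ eLpNorm (fun x => (h x : ℂ)) ⊤ (μ.restrict A) * eLpNorm f 2 (μ.restrict A) :=
        eLpNorm_smul_le_mul_eLpNorm hf.restrict hh'.restrict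
    _ ≤ eLpNorm h ⊤ μ * eLpNorm f 2 (μ.restrict A) := by
        gcongr
        refine (eLpNorm_mono_measure _ Measure.restrict_le_self).trans_eq ?_
        exact eLpNorm_congr_norm_ae (.of_forall fun x => Complex.norm_real (h x))

theorem norm_multiplicationOperator_sub_le {ι : Type*} [Fintype ι] {q q' : α → ℝ}
    (hq : MemLp q ⊤ μ) (hq' : MemLp q' ⊤ μ) {A : ι → Set α} (hA : ∀ i, MeasurableSet (A i))
    {h : ι → α → ℝ} (hh : ∀ i, MemLp (h i) ⊤ μ)
    (hqq' : ∀ x, q x = q' x + ∑ i, (A i).indicator (h i) x) (f : Lp ℂ 2 μ) :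
    ‖multiplicationOperator hq f - multiplicationOperator hq' f‖
      ≤ ∑ i, (eLpNorm (h i) ⊤ μ).toReal * (eLpNorm f 2 (μ.restrict (A i))).toReal := by
  have hfin : ∀ i, eLpNorm (h i) ⊤ μ * eLpNorm f 2 (μ.restrict (A i)) ≠ ⊤ := fun i =>
    ENNReal.mul_ne_top (hh i).2.ne ((Lp.memLp f).restrict (A i)).2.ne
  have hmul : (multiplicationOperator hq f - multiplicationOperator hq' f : Lp ℂ 2 μ)
      =ᵐ[μ] ∑ i, (A i).indicator fun x => (h i x : ℂ) * f x := by
    filter_upwards [Lp.coeFn_sub (multiplicationOperator hq f) (multiplicationOperator hq' f),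
      coeFn_multiplicationOperator hq f, coeFn_multiplicationOperator hq' f] with x hsub hx hx'
    rw [hsub, Pi.sub_apply, hx, hx', ← sub_mul, ← Complex.ofReal_sub, hqq', add_sub_cancel_left,
      Complex.ofReal_sum, Finset.sum_mul, Finset.sum_apply]
    refine Finset.sum_congr rfl fun i _ => ?_
    by_cases hi : x ∈ A i <;> simp [hi]
  have hle : eLpNorm (multiplicationOperator hq f - multiplicationOperator hq' f : Lp ℂ 2 μ) 2 μ
      ≤ ∑ i, eLpNorm (h i) ⊤ μ * eLpNorm f 2 (μ.restrict (A i)) := by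
    rw [eLpNorm_congr_ae hmul]
    refine (eLpNorm_sum_le (fun i _ => ?_) one_le_two).trans (Finset.sum_le_sum fun i _ =>
      eLpNorm_indicator_mul_le (hh i).1 (hA i) (Lp.aestronglyMeasurable f))
    exact ((Complex.continuous_ofReal.comp_aestronglyMeasurable (hh i).1).mul
      (Lp.aestronglyMeasurable f)).indicator (hA i)
  rw [Lp.norm_def]
  refine (ENNReal.toReal_mono (ENNReal.sum_ne_top.2 fun i _ => hfin i) hle).trans_eq ?_
  simp only [ENNReal.toReal_sum fun i _ => hfin i, ENNReal.toReal_mul]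

theorem continuous_integral_mul_ofReal {ψ : α → ℝ} (hψ : MemLp (fun x => (ψ x : ℂ)) 2 μ) :
    Continuous fun f : Lp ℂ 2 μ => ∫ x, f x * (ψ x : ℂ) ∂μ := by
  have hinner : ∀ f : Lp ℂ 2 μ, inner ℂ hψ.toLp f = ∫ x, f x * (ψ x : ℂ) ∂μ := fun f => by
    rw [L2.inner_def]
    refine integral_congr_ae ?_
    filter_upwards [hψ.coeFn_toLp] with x hx
    rw [hx, RCLike.inner_apply, Complex.conj_ofReal]
  simp only [← hinner]
  fun_prop

end Multiplication

variable {d : ℕ} {D : Set (E d)}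

theorem isClosed_H1 (D : Set (E d)) : IsClosed (H1 D : Set (L2Pair D)) := by
  have hH1 : (H1 D : Set (L2Pair D)) = ⋂ (φ : E d → ℝ) (_ : IsTest D φ) (i : Fin d),
      {p | ∫ x in D, p.fst x * (partialDeriv i φ x : ℂ) = -∫ x in D, p.snd x i * (φ x : ℂ)} := by
    ext p
    simp only [Set.mem_iInter, Set.mem_ofPred_eq]
    rfl
  rw [hH1]
  refine isClosed_iInter fun φ => isClosed_iInter fun hφ => isClosed_iInter fun i =>
    isClosed_eq ?_ (Continuous.neg ?_)
  · exact (continuous_integral_mul_ofReal (hφ.memLp_partialDeriv i)).comp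
      (WithLp.prod_continuous_ofLp 2 _ _).fst
  · have hcomp := (continuous_integral_mul_ofReal hφ.memLp).comp
      (((EuclideanSpace.proj (𝕜 := ℂ) i).compLpL 2 (vol D)).continuous.comp
        (WithLp.prod_continuous_ofLp 2 (Lp ℂ 2 (vol D))
          (Lp (EuclideanSpace ℂ (Fin d)) 2 (vol D))).snd)
    refine hcomp.congr fun p => integral_congr_ae ?_
    filter_upwards [(EuclideanSpace.proj (𝕜 := ℂ) i).coeFn_compLpL (p := 2) p.snd] with x hx
    exact congrArg (· * (φ x : ℂ)) hx

theorem isClosed_X (D : Set (E d)) :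
    IsClosed (X D : Set (WithLp 2 (L2Pair D × L2Pair D))) := by
  have hfst : Continuous fun p : WithLp 2 (L2Pair D × L2Pair D) => p.fst :=
    (WithLp.prod_continuous_ofLp 2 _ _).fst
  have hsnd : Continuous fun p : WithLp 2 (L2Pair D × L2Pair D) => p.snd :=
    (WithLp.prod_continuous_ofLp 2 _ _).snd
  exact ((isClosed_H1 D).preimage hfst).inter (((isClosed_H1 D).preimage hsnd).inter
    ((Submodule.isClosed_topologicalClosure _).preimage (hfst.sub hsnd)))

instance completeSpace_X (D : Set (E d)) : CompleteSpace (X D) :=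
  (isClosed_X D).completeSpace_coe

/-- The map `(w, v) ↦ w` from `X(D)` to `L²(D)`. -/
def wL (D : Set (E d)) : X D →L[ℂ] Lp ℂ 2 (vol D) :=
  LinearMap.mkContinuous
    { toFun := fun p => (p : WithLp 2 (L2Pair D × L2Pair D)).fst.fst
      map_add' := fun _ _ => rfl
      map_smul' := fun _ _ => rfl } 1
    fun _ => ((WithLp.norm_fst_le _ _).trans (WithLp.norm_fst_le _ _)).trans_eq (one_mul _).symm

/-- The map `(w, v) ↦ v` from `X(D)` to `L²(D)`. -/
def vL (D : Set (E d)) : X D →L[ℂ] Lp ℂ 2 (vol D) :=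
  LinearMap.mkContinuous
    { toFun := fun p => (p : WithLp 2 (L2Pair D × L2Pair D)).snd.fst
      map_add' := fun _ _ => rfl
      map_smul' := fun _ _ => rfl } 1
    fun _ => ((WithLp.norm_fst_le _ _).trans (WithLp.norm_snd_le _ _)).trans_eq (one_mul _).symm

theorem norm_wL_le (D : Set (E d)) : ‖wL D‖ ≤ 1 :=
  LinearMap.mkContinuous_norm_le _ zero_le_one _

theorem toReal_eLpNorm_wL_restrict_ball_le [NeZero d] (p : X D) {z : E d} {c₀ r : ℝ}
    (hc₀ : 0 < c₀) (hD : Metric.ball z c₀ ⊆ D) (hr : 0 < r) :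
    (eLpNorm (wL D p) 2 ((vol D).restrict (Metric.ball z r))).toReal
      ≤ (1 + 2 / c₀) * √(2 * c₀ * r) * ‖p‖ :=
  (toReal_eLpNorm_restrict_ball_le p.2.1 hc₀ hD hr).trans <| by
    gcongr
    exact WithLp.norm_fst_le _ _

/-- The operator `B_q` on `X(D)` that represents the form `∫_D q w conj(φ₁) - v conj(φ₂) dx`. -/
def formOperator {q : E d → ℝ} (hq : MemLp q ⊤ (vol D)) : X D →L[ℂ] X D :=
  pullbackOperator (wL D) (vL D) (multiplicationOperator hq)

theorem isOperatorOf_formOperator {q : E d → ℝ} (hq : MemLp q ⊤ (vol D)) :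
    IsOperatorOf D q (formOperator hq) := by
  intro p φ
  have hint : ∀ f g : Lp ℂ 2 (vol D), Integrable (fun x => f x * conj (g x)) (vol D) :=
    fun f g => (Lp.memLp f).integrable_mul (Lp.memLp g).star
  rw [formOperator, inner_pullbackOperator, L2.inner_def, L2.inner_def]
  simp only [RCLike.inner_apply]
  rw [← integral_sub (hint _ _) (hint _ _)]
  refine integral_congr_ae ?_
  filter_upwards [coeFn_multiplicationOperator hq (wL D p)] with x hx
  rw [hx]
  rfl

theorem norm_formOperator_sub_le {q q' : E d → ℝ} (hq : MemLp q ⊤ (vol D))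
    (hq' : MemLp q' ⊤ (vol D)) {C : ℝ} (hC : 0 ≤ C)
    (h : ∀ p : X D, ‖multiplicationOperator hq (wL D p) - multiplicationOperator hq' (wL D p)‖
      ≤ C * ‖p‖) :
    ‖formOperator hq - formOperator hq'‖ ≤ C :=
  (norm_pullbackOperator_sub_le (wL D) (vL D) hC h).trans
    (mul_le_of_le_one_left hC (norm_wL_le D))

theorem tendsto_of_norm_sub_le_mul_rpow {G : Type*} [SeminormedAddCommGroup G] {f : ℝ → G}
    {a : G} {C α : ℝ} (hα : 0 < α) (h : ∀ᶠ ε in 𝓝[>] 0, ‖f ε - a‖ ≤ C * ε ^ α) :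
    Tendsto f (𝓝[>] 0) (𝓝 a) := by
  have hlim : Tendsto (fun ε : ℝ => C * ε ^ α) (𝓝[>] 0) (𝓝 0) := by
    have hcont : Continuous fun ε : ℝ => C * ε ^ α :=
      continuous_const.mul (Real.continuous_rpow_const hα.le)
    simpa [hα.ne'] using (hcont.tendsto 0).mono_left nhdsWithin_le_nhds
  exact tendsto_iff_norm_sub_tendsto_zero.2
    (squeeze_zero' (.of_forall fun _ => norm_nonneg _) h hlim)

end Operators

section Defects

theorem ball_subset_of_le_infDist_frontier {V : Type*} [SeminormedAddCommGroup V]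
    [NormedSpace ℝ V] {D : Set V} {z : V} (hz : z ∈ D) {c : ℝ}
    (h : c ≤ Metric.infDist z (frontier D)) : Metric.ball z c ⊆ D := by
  rcases le_or_gt c 0 with hc | hc
  · rw [Metric.ball_eq_empty.2 hc]
    exact Set.empty_subset D
  have hdisjoint : Disjoint (Metric.ball z c) (frontier D) :=
    Metric.disjoint_ball_infDist.mono_left (Metric.ball_subset_ball h)
  have hinterior : ∀ x ∈ Metric.ball z c, x ∈ closure D → x ∈ interior D := fun x hx hxD =>
    by_contra fun hxi => Set.disjoint_left.1 hdisjoint hx ⟨hxD, hxi⟩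
  have hzc : z ∈ Metric.ball z c := Metric.mem_ball_self hc
  exact ((convex_ball z c).isPreconnected.subset_of_closure_inter_subset isOpen_interior
    ⟨z, hzc, hinterior z hzc (subset_closure hz)⟩ fun x hx =>
      hinterior x hx.2 (closure_mono interior_subset hx.1)).trans interior_subset

variable {d M : ℕ} {D : Set (E d)} {n : E d → ℝ} {z : Fin M → E d} {S : Fin M → Set (E d)}
  {nm : Fin M → ℝ} {c₀ R ε : ℝ}

theorem defect_subset_ball {m : Fin M} (hS : S m ⊆ Metric.ball 0 R) (hε : 0 < ε) :
    defect z S ε m ⊆ Metric.ball (z m) (ε * R) := by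
  rintro _ ⟨y, hy, rfl⟩
  rw [mem_ball_iff_norm, add_sub_cancel_left, norm_smul, Real.norm_of_nonneg hε.le]
  exact mul_lt_mul_of_pos_left (mem_ball_zero_iff.1 (hS hy)) hε

theorem measurableSet_defect {m : Fin M} (hS : MeasurableSet (S m)) (hε : ε ≠ 0) :
    MeasurableSet (defect z S ε m) :=
  ((Homeomorph.smulOfNeZero ε hε).trans
    (Homeomorph.addLeft (z m))).measurableEmbedding.measurableSet_image.2 hS

theorem perturbed_of_mem (h : Admissible z S ε) {m : Fin M} {x : E d}
    (hx : x ∈ defect z S ε m) : perturbed n z S nm ε x = nm m := by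
  have hex : ∃ m, x ∈ defect z S ε m := ⟨m, hx⟩
  rw [perturbed, dif_pos hex]
  congr 1
  by_contra hne
  exact Set.disjoint_left.1 (h.2 hne) hex.choose_spec hx

theorem perturbed_eq_add_sum_indicator (h : Admissible z S ε) (x : E d) :
    perturbed n z S nm ε x
      = n x + ∑ m, (defect z S ε m).indicator (fun x => nm m - n x) x := by
  by_cases hx : ∃ m, x ∈ defect z S ε m
  · obtain ⟨m, hm⟩ := hx
    have hother : ∀ j ≠ m, (defect z S ε j).indicator (fun x => nm j - n x) x = 0 :=
      fun j hj => Set.indicator_of_notMem (Set.disjoint_right.1 (h.2 hj) hm) _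
    rw [perturbed_of_mem h hm, Fintype.sum_eq_single m hother, Set.indicator_of_mem hm,
      add_sub_cancel]
  · have hnone : ∀ m, (defect z S ε m).indicator (fun x => nm m - n x) x = 0 :=
      fun m => Set.indicator_of_notMem (not_exists.1 hx m) _
    rw [perturbed, dif_neg hx, Fintype.sum_eq_zero _ hnone, add_zero]

theorem memLp_perturbed (hn : MemLp n ⊤ (vol D)) (nm : Fin M → ℝ)
    (hS : ∀ m, MeasurableSet (S m)) (h : Admissible z S ε) :
    MemLp (perturbed n z S nm ε) ⊤ (vol D) := by
  rw [funext (perturbed_eq_add_sum_indicator h)]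
  exact hn.add (memLp_finsetSum _ fun m _ =>
    ((memLp_top_const (nm m)).sub hn).indicator (measurableSet_defect (hS m) h.1.ne'))

theorem norm_formOperator_perturbed_sub_le [NeZero d] (hn : MemLp n ⊤ (vol D))
    (nm : Fin M → ℝ) (hS : ∀ m, MeasurableSet (S m))
    (hSR : ∀ m, S m ⊆ Metric.ball 0 R) (hR : 0 < R) (hc₀ : 0 < c₀)
    (hD : ∀ m, Metric.ball (z m) c₀ ⊆ D) (h : Admissible z S ε) :
    ‖formOperator (memLp_perturbed hn nm hS h) - formOperator hn‖
      ≤ (∑ m, (eLpNorm (fun x => nm m - n x) ⊤ (vol D)).toReal)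
        * ((1 + 2 / c₀) * √(2 * c₀ * R)) * ε ^ (1 / 2 : ℝ) := by
  have hε := h.1
  refine norm_formOperator_sub_le _ hn (by positivity) fun p => ?_
  have hloc : ∀ m, (eLpNorm (wL D p) 2 ((vol D).restrict (defect z S ε m))).toReal
      ≤ (1 + 2 / c₀) * √(2 * c₀ * R) * ε ^ (1 / 2 : ℝ) * ‖p‖ := fun m => calc
    _ ≤ (eLpNorm (wL D p) 2 ((vol D).restrict (Metric.ball (z m) (ε * R)))).toReal :=
      ENNReal.toReal_mono ((Lp.memLp (wL D p)).restrict _).2.ne <| eLpNorm_mono_measure _ <|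
        Measure.restrict_mono_set _ (defect_subset_ball (hSR m) hε)
    _ ≤ (1 + 2 / c₀) * √(2 * c₀ * (ε * R)) * ‖p‖ :=
      toReal_eLpNorm_wL_restrict_ball_le p hc₀ (hD m) (mul_pos hε hR)
    _ = _ := by
      rw [mul_comm ε, ← mul_assoc, Real.sqrt_mul' _ hε.le, ← Real.sqrt_eq_rpow, ← mul_assoc]
  refine (norm_multiplicationOperator_sub_le (h := fun m x => nm m - n x) _ hn
    (fun m => measurableSet_defect (hS m) hε.ne') (fun m => (memLp_top_const (nm m)).sub hn)
    (perturbed_eq_add_sum_indicator h) (wL D p)).trans ?_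
  rw [Finset.sum_mul, Finset.sum_mul, Finset.sum_mul]
  refine Finset.sum_le_sum fun m _ => ?_
  exact (mul_le_mul_of_nonneg_left (hloc m) ENNReal.toReal_nonneg).trans_eq (by ring)

theorem eventually_admissible (hc₀ : 0 < c₀) (hsep : ∀ i j, i ≠ j → c₀ ≤ dist (z i) (z j))
    (hD : ∀ m, Metric.ball (z m) c₀ ⊆ D) (hR : 0 < R) (hSR : ∀ m, S m ⊆ Metric.ball 0 R) :
    ∀ᶠ ε in 𝓝[>] (0 : ℝ), Admissible z S ε ∧ ∀ m, defect z S ε m ⊆ D := by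
  filter_upwards [Ioo_mem_nhdsGT (show 0 < c₀ / (2 * R) by positivity)] with ε hε
  have hεR : ε * R ≤ c₀ / 2 := by
    have := (lt_div_iff₀ (by positivity)).1 hε.2
    linarith
  have hsub : ∀ m, defect z S ε m ⊆ Metric.ball (z m) (c₀ / 2) := fun m =>
    (defect_subset_ball (hSR m) hε.1).trans (Metric.ball_subset_ball hεR)
  refine ⟨⟨hε.1, fun i j hij => .mono (hsub i) (hsub j) <| Metric.ball_disjoint_ball ?_⟩,
    fun m => (hsub m).trans ((Metric.ball_subset_ball (half_le_self hc₀.le)).trans (hD m))⟩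
  linarith [hsep i j hij]

theorem mainTheorem5_general [NeZero d] (hn : MemLp n ⊤ (vol D)) (nm : Fin M → ℝ)
    (hc₀ : 0 < c₀) (hsep : ∀ i j, i ≠ j → c₀ ≤ dist (z i) (z j))
    (hz : ∀ m, Metric.ball (z m) c₀ ⊆ D)
    (hS : ∀ m, MeasurableSet (S m) ∧ Bornology.IsBounded (S m)) :
    (∀ᶠ ε in 𝓝[>] (0 : ℝ), Admissible z S ε ∧ ∀ m, defect z S ε m ⊆ D) ∧
    ∃ (B₀ : X D →L[ℂ] X D) (B : ℝ → (X D →L[ℂ] X D)),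
      IsOperatorOf D n B₀ ∧
      (∀ ε, Admissible z S ε → IsOperatorOf D (perturbed n z S nm ε) (B ε)) ∧
      Tendsto B (𝓝[>] 0) (𝓝 B₀) ∧
      ∃ C : ℝ, ∀ ε, Admissible z S ε → ‖B ε - B₀‖ ≤ C * ε ^ (1 / 2 : ℝ) := by
  obtain ⟨R, hR, hSR⟩ :=
    (Bornology.isBounded_iUnion.2 fun m => (hS m).2).subset_ball_lt 0 (0 : E d)
  have hSR : ∀ m, S m ⊆ Metric.ball 0 R := fun m => (Set.subset_iUnion S m).trans hSR
  have hadm := eventually_admissible hc₀ hsep hz hR hSR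
  choose! B hB hrate using fun ε (h : Admissible z S ε) =>
    (⟨_, isOperatorOf_formOperator (memLp_perturbed hn nm (fun m => (hS m).1) h),
      norm_formOperator_perturbed_sub_le hn nm (fun m => (hS m).1) hSR hR hc₀ hz h⟩ :
      ∃ T, IsOperatorOf D (perturbed n z S nm ε) T ∧ ‖T - formOperator hn‖ ≤ _ * ε ^ (1 / 2 : ℝ))
  refine ⟨hadm, formOperator hn, B, isOperatorOf_formOperator hn, hB, ?_, _, hrate⟩
  exact tendsto_of_norm_sub_le_mul_rpow (G := X D →L[ℂ] X D) (by norm_num)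
    (hadm.mono fun ε hε => hrate ε hε.1)

end Defects

end Transmission

end

open Transmission in
theorem mainTheorem5 (d : ℕ) (hd : d = 2 ∨ d = 3) :
    ∃ α ∈ Set.Ioo (0 : ℝ) 1,
      ∀ (D : Set (E d)), IsOpen D → IsConnected D → Bornology.IsBounded D →
      ∀ (n : E d → ℝ), ContDiffOn ℝ 1 n D → (∃ K : ℝ, ∀ x ∈ D, |n x| ≤ K) →
      ∀ (M : ℕ) (z : Fin M → E d) (S : Fin M → Set (E d)) (nm : Fin M → ℝ) (c₀ : ℝ), 0 < c₀ →
      (∀ i j, i ≠ j → c₀ ≤ dist (z i) (z j)) →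
      (∀ m, z m ∈ D ∧ c₀ ≤ Metric.infDist (z m) (frontier D)) →
      (∀ m, IsOpen (S m) ∧ Bornology.IsBounded (S m)) →
      (∀ᶠ ε in 𝓝[>] (0 : ℝ), Admissible z S ε ∧ ∀ m, defect z S ε m ⊆ D) ∧
      ∃ (B₀ : X D →L[ℂ] X D) (B : ℝ → (X D →L[ℂ] X D)),
        IsOperatorOf D n B₀ ∧
        (∀ ε, Admissible z S ε → IsOperatorOf D (perturbed n z S nm ε) (B ε)) ∧
        Tendsto B (𝓝[>] 0) (𝓝 B₀) ∧
        ∃ C : ℝ, ∀ ε, Admissible z S ε → ‖B ε - B₀‖ ≤ C * ε ^ α := by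
  have : NeZero d := ⟨by rcases hd with rfl | rfl <;> norm_num⟩
  refine ⟨1 / 2, by norm_num, fun D hD _ _ n hn ⟨K, hK⟩ M z S nm c₀ hc₀ hsep hz hS => ?_⟩
  exact mainTheorem5_general (memLp_top_of_bound
      (hn.continuousOn.aestronglyMeasurable hD.measurableSet) K
      (ae_restrict_of_forall_mem hD.measurableSet hK))
    nm hc₀ hsep (fun m => ball_subset_of_le_infDist_frontier (hz m).1 (hz m).2)
    fun m => ⟨(hS m).1.measurableSet, (hS m).2⟩
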